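/- Let $\zeta$ be the Riemann zeta function and let $$Z=\{\,s\in\mathbb{C}: \Re(s)\ge 0,\ \Im(s)\ge 0,\ \zeta(s)=0\,\}$$ (the non-trivial zeros of $\zeta$ with non-negative imaginary part), partially ordered by the coordinatewise order: $a+ib\le c+id$ if and only if $a\le c$ and $b\le d$ (for $a,b,c,d\in\mathbb{R}$). If $(Z,\le)$ has at least one maximal element, then the Riemann hypothesis is false. -/

import Mathlib

/-- The complex numbers, to be equipped with the coordinatewise order
(Mathlib's own scoped order on `ℂ` is a different one). -/
def CoordComplex : Type := ℂ

namespace CoordComplex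

/-- The underlying complex number. -/
def toComplex (z : CoordComplex) : ℂ := z

/-- A complex number, seen in the coordinatewise ordered copy of `ℂ`. -/
def ofComplex (z : ℂ) : CoordComplex := z

/-- The coordinatewise order: `a + i b ≤ c + i d` if and only if `a ≤ c` and `b ≤ d`. -/
instance instPartialOrder : PartialOrder CoordComplex where
  le z w := z.toComplex.re ≤ w.toComplex.re ∧ z.toComplex.im ≤ w.toComplex.im
  le_refl _ := ⟨le_rfl, le_rfl⟩
  le_trans _ _ _ h k := ⟨h.1.trans k.1, h.2.trans k.2⟩
  le_antisymm _ _ h k := Complex.ext (le_antisymm h.1 k.1) (le_antisymm h.2 k.2)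

theorem le_def (z w : CoordComplex) :
    z ≤ w ↔ z.toComplex.re ≤ w.toComplex.re ∧ z.toComplex.im ≤ w.toComplex.im :=
  Iff.rfl

end CoordComplex

/-- The set `Z = {s : 0 ≤ s, ζ(s) = 0}`, where `≤` is the coordinatewise order. Its elements inherit
the coordinatewise order through the subtype. The pole `s = 1` does not belong to it, since the
value that Mathlib assigns to `riemannZeta 1` is nonzero. -/
def zetaZeroPoset : Set CoordComplex :=
  {s | CoordComplex.ofComplex 0 ≤ s ∧ riemannZeta s.toComplex = 0}

/-! Under the Riemann hypothesis all of `Z` lies on the line `re s = 1/2`, where the order compares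
heights only, so a maximal element would be a highest zero. It thus suffices to find zeros of
arbitrarily large height. This is Hadamard's argument for `zetaXi`, which has order at most `3/2`.
With finitely many zeros it would be `p * exp g`, `p` being essentially a polynomial;
Borel–Carathéodory and Cauchy's estimate make `g` affine, so `zetaXi` would have exponential type
(`Complex.exists_norm_le_exp_of_finite_zeros`). But at `2n + 2` it is at least `n! / π ^ (n + 1)`.
So there are infinitely many zeros; they are locally finite, and `s ↦ 1 - s` negates heights, so
heights are unbounded above. -/

open Complex Filter Topology Metric MeasureTheory

/-! ### Entire functions with finitely many zeros -/

/-- An entire function which is not identically zero and has only finitely many zeros is the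
product of an entire function without zeros and a function of exponential type which is
bounded below near infinity. -/
theorem Complex.exists_eq_mul_of_zeros_subset (S : Finset ℂ) :
    ∀ f : ℂ → ℂ, Differentiable ℂ f → (∃ z, f z ≠ 0) → (∀ z, f z = 0 → z ∈ S) →
      ∃ p h : ℂ → ℂ, Differentiable ℂ h ∧ (∀ z, h z ≠ 0) ∧ (∀ z, f z = p z * h z) ∧
        (∃ C : ℝ, ∀ z, ‖p z‖ ≤ Real.exp (C * (1 + ‖z‖))) ∧
        ∃ R : ℝ, ∀ z, R ≤ ‖z‖ → 1 ≤ ‖p z‖ := by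
  induction S using Finset.induction_on with
  | empty =>
    intro f hf _ h0
    exact ⟨fun _ ↦ 1, f, hf, fun z hz ↦ by simpa using h0 z hz, fun z ↦ (one_mul _).symm,
      ⟨0, fun z ↦ by simp⟩, 0, fun z _ ↦ by simp⟩
  | insert a S _ ih =>
    intro f hf hne h0
    have hfa : AnalyticAt ℂ f a := hf.analyticAt a
    have htop : analyticOrderAt f a ≠ ⊤ := by
      intro htop
      obtain ⟨z, hz⟩ := hne
      have hfU : AnalyticOnNhd ℂ f Set.univ := fun z _ ↦ hf.analyticAt z
      have := hfU.eqOn_zero_of_preconnected_of_eventuallyEq_zero isPreconnected_univ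
        (Set.mem_univ a) (analyticOrderAt_eq_top.1 htop)
      exact hz (this (Set.mem_univ z))
    obtain ⟨g, hg, hga, hfg⟩ := hfa.analyticOrderAt_ne_top.1 htop
    set n := analyticOrderNatAt f a
    -- The quotient with its removable singularity at `a` filled in.
    set k : ℂ → ℂ := Function.update (fun z ↦ f z / (z - a) ^ n) a (g a) with hk
    have hkg : k =ᶠ[𝓝 a] g := by
      filter_upwards [hfg] with z hz
      rcases eq_or_ne z a with rfl | hza
      · simp [hk]
      · have : z - a ≠ 0 := sub_ne_zero.2 hza
        simp only [hk, Function.update_of_ne hza, hz, smul_eq_mul]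
        field_simp
    have hfk : ∀ z, f z = (z - a) ^ n * k z := by
      intro z
      rcases eq_or_ne z a with rfl | hza
      · simpa [hk] using hfg.self_of_nhds
      · have : z - a ≠ 0 := sub_ne_zero.2 hza
        simp only [hk, Function.update_of_ne hza]
        field_simp
    have hkd : Differentiable ℂ k := by
      intro z
      rcases eq_or_ne z a with rfl | hza
      · exact (hkg.differentiableAt_iff).2 hg.differentiableAt
      · have hd : DifferentiableAt ℂ (fun z ↦ f z / (z - a) ^ n) z :=
          (hf z).div (by fun_prop) (pow_ne_zero _ (sub_ne_zero.2 hza))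
        refine (Filter.EventuallyEq.differentiableAt_iff ?_).2 hd
        filter_upwards [isOpen_ne.mem_nhds hza] with w hw
        simp [hk, Function.update_of_ne hw]
    have hka : k a ≠ 0 := by simpa [hk] using hga
    obtain ⟨p, h, hh, hh0, hkph, ⟨C, hC⟩, R, hR⟩ := ih k hkd ⟨a, hka⟩ fun z hz ↦ by
      have hfz : f z = 0 := by rw [hfk, hz, mul_zero]
      rcases Finset.mem_insert.1 (h0 z hfz) with rfl | hzS
      · exact absurd hz hka
      · exact hzS
    refine ⟨fun z ↦ (z - a) ^ n * p z, h, hh, hh0, fun z ↦ ?_, ⟨n * (1 + ‖a‖) + C, fun z ↦ ?_⟩,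
      max R (‖a‖ + 1), fun z hz ↦ ?_⟩
    · rw [hfk, hkph, mul_assoc]
    · rw [norm_mul, norm_pow, add_mul, Real.exp_add, mul_assoc, Real.exp_nat_mul]
      gcongr
      · calc ‖z - a‖ ≤ ‖z‖ + ‖a‖ := norm_sub_le _ _
          _ ≤ (1 + ‖a‖) * (1 + ‖z‖) + 1 := by nlinarith [norm_nonneg a, norm_nonneg z]
          _ ≤ _ := Real.add_one_le_exp _
      · exact hC z
    · rw [norm_mul, norm_pow]
      have h1 : 1 ≤ ‖z - a‖ := by
        have := norm_sub_norm_le z a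
        linarith [le_max_right R (‖a‖ + 1)]
      exact one_le_mul_of_one_le_of_one_le (one_le_pow₀ h1) (hR z ((le_max_left _ _).trans hz))

/-- An entire function without zeros is the exponential of an entire function. -/
theorem Complex.exists_eq_exp {h : ℂ → ℂ} (hh : Differentiable ℂ h) (h0 : ∀ z, h z ≠ 0) :
    ∃ g : ℂ → ℂ, Differentiable ℂ g ∧ ∀ z, h z = exp (g z) := by
  have hq : Differentiable ℂ (fun z ↦ deriv h z / h z) := hh.deriv.div hh h0
  obtain ⟨g, hg0, hg⟩ := hq.isExactOn_univ.with_val_at 0 (log (h 0))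
  have hg' : ∀ z, HasDerivAt g (deriv h z / h z) z := fun z ↦ hg z (Set.mem_univ z)
  have hgd : Differentiable ℂ g := fun z ↦ (hg' z).differentiableAt
  refine ⟨g, hgd, fun z ↦ ?_⟩
  have hd : ∀ z, HasDerivAt (fun z ↦ h z * exp (-g z)) 0 z := fun z ↦ by
    refine ((hh z).hasDerivAt.mul (hg' z).neg.cexp).congr_deriv ?_
    have := h0 z
    field_simp
    ring
  have hc := is_const_of_deriv_eq_zero (fun z ↦ (hd z).differentiableAt)
    (fun z ↦ (hd z).deriv) z 0
  simp only [hg0, exp_neg, exp_log (h0 0), mul_inv_cancel₀ (h0 0)] at hc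
  have := exp_ne_zero (g z)
  field_simp at hc
  exact hc

/-- An entire function whose real part grows at most like `‖z‖ ^ (3 / 2)` is affine, hence grows at
most linearly. -/
theorem Complex.exists_norm_le_of_re_le {g : ℂ → ℂ} (hg : Differentiable ℂ g) {C : ℝ}
    (hC : ∀ z, (g z).re ≤ C * (1 + ‖z‖) ^ (3 / 2 : ℝ)) :
    ∃ A : ℝ, ∀ z, ‖g z‖ ≤ A * (1 + ‖z‖) := by
  wlog hC0 : 0 < C generalizing C
  · refine this (C := 1) (fun z ↦ (hC z).trans ?_) one_pos
    gcongr
    linarith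
  -- Borel–Carathéodory on the disc of radius `2 * R`; the ratios `R / (2R - R)` and `(2R + R) / (2R
  -- - R)` give the factors 2 and 3.
  have hbc (R : ℝ) (hR : 0 < R) (z : ℂ) (hz : ‖z‖ ≤ R) :
      ‖g z‖ ≤ 2 * (C * (1 + 2 * R) ^ (3 / 2 : ℝ)) + 3 * ‖g 0‖ := by
    have hM : 0 < C * (1 + 2 * R) ^ (3 / 2 : ℝ) := by positivity
    have hmem : z ∈ ball (0 : ℂ) (2 * R) := by
      rw [mem_ball_zero_iff]; linarith
    have key := borelCaratheodory hM hg.differentiableOn (fun w hw ↦ ?_) (by positivity) hmem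
    · refine key.trans (add_le_add ?_ ?_)
      · rw [div_le_iff₀ (by linarith)]
        gcongr
        linarith
      · rw [div_le_iff₀ (by linarith)]
        nlinarith [norm_nonneg (g 0)]
    · refine (hC w).trans ?_
      rw [mem_ball_zero_iff] at hw
      gcongr
  have h2 : ∀ c, deriv (deriv g) c = 0 := by
    intro c
    -- Cauchy's estimate on a circle of radius `R` about `c`: the bound is of order `R ^ (3/2 - 2)`.
    have hle : ∀ᶠ R : ℝ in atTop, ‖deriv (deriv g) c‖ ≤
        32 * C * R ^ (-(1 / 2) : ℝ) + 6 * ‖g 0‖ * R ^ (-2 : ℝ) := by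
      filter_upwards [eventually_ge_atTop (1 + 2 * ‖c‖)] with R hR
      have hc0 := norm_nonneg c
      have hR0 : 0 < R := by linarith
      have hcau := norm_iteratedDeriv_le_of_forall_mem_sphere_norm_le 2 hR0
        (hg.diffContOnCl (s := ball c R)) fun z hz ↦
          hbc (R + ‖c‖) (by linarith) z (by
            have := norm_le_norm_add_norm_sub' z c
            rw [mem_sphere_iff_norm] at hz
            linarith)
      rw [iteratedDeriv_succ, iteratedDeriv_one] at hcau
      refine hcau.trans ?_
      have h1 : (1 + 2 * (R + ‖c‖)) ^ (3 / 2 : ℝ) ≤ 8 * R ^ (3 / 2 : ℝ) := by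
        calc (1 + 2 * (R + ‖c‖)) ^ (3 / 2 : ℝ) ≤ (4 * R) ^ (3 / 2 : ℝ) := by
              gcongr; linarith
          _ = 8 * R ^ (3 / 2 : ℝ) := by
              rw [Real.mul_rpow (by norm_num) hR0.le]
              congr 1
              rw [show (4 : ℝ) = 2 ^ (2 : ℝ) by norm_num, ← Real.rpow_mul (by norm_num)]
              norm_num
      rw [div_le_iff₀ (by positivity)]
      have e1 : R ^ (-(1 / 2) : ℝ) * R ^ 2 = R ^ (3 / 2 : ℝ) := by
        rw [← Real.rpow_natCast, ← Real.rpow_add hR0]; norm_num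
      have e2 : R ^ (-2 : ℝ) * R ^ 2 = 1 := by
        rw [← Real.rpow_natCast, ← Real.rpow_add hR0]; norm_num
      calc (Nat.factorial 2 : ℝ) * (2 * (C * (1 + 2 * (R + ‖c‖)) ^ (3 / 2 : ℝ)) + 3 * ‖g 0‖)
          ≤ (Nat.factorial 2 : ℝ) * (2 * (C * (8 * R ^ (3 / 2 : ℝ))) + 3 * ‖g 0‖) := by gcongr
        _ = 32 * C * (R ^ (-(1 / 2) : ℝ) * R ^ 2) + 6 * ‖g 0‖ * (R ^ (-2 : ℝ) * R ^ 2) := by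
            rw [e1, e2]; norm_num [Nat.factorial]; ring
        _ = _ := by ring
    have hlim : Tendsto (fun R : ℝ ↦ 32 * C * R ^ (-(1 / 2) : ℝ) + 6 * ‖g 0‖ * R ^ (-2 : ℝ))
        atTop (𝓝 0) := by
      simpa using ((tendsto_rpow_neg_atTop (y := 1 / 2) (by norm_num)).const_mul (32 * C)).add
        ((tendsto_rpow_neg_atTop (y := 2) (by norm_num)).const_mul (6 * ‖g 0‖))
    exact norm_le_zero_iff.1 (ge_of_tendsto hlim hle)
  have h1 : ∀ z, deriv g z = deriv g 0 := fun z ↦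
    is_const_of_deriv_eq_zero hg.deriv h2 z 0
  have hd : ∀ z, HasDerivAt (fun z ↦ g z - deriv g 0 * z) 0 z := fun z ↦ by
    refine ((hg z).hasDerivAt.sub ((hasDerivAt_id z).const_mul (deriv g 0))).congr_deriv ?_
    simp [h1 z]
  refine ⟨‖g 0‖ + ‖deriv g 0‖, fun z ↦ ?_⟩
  have hc := is_const_of_deriv_eq_zero (fun z ↦ (hd z).differentiableAt)
    (fun z ↦ (hd z).deriv) z 0
  simp only [mul_zero, sub_zero, sub_eq_iff_eq_add] at hc
  rw [hc]
  calc _ ≤ ‖g 0‖ + ‖deriv g 0‖ * ‖z‖ := by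
        rw [← norm_mul]; exact norm_add_le _ _
    _ ≤ _ := by nlinarith [norm_nonneg (g 0), norm_nonneg (deriv g 0), norm_nonneg z]

/-- An entire function of growth order at most `3 / 2` with finitely many zeros is of
exponential type. -/
theorem Complex.exists_norm_le_exp_of_finite_zeros {f : ℂ → ℂ} (hf : Differentiable ℂ f)
    (hne : ∃ z, f z ≠ 0) (hfin : {z | f z = 0}.Finite) {C : ℝ}
    (hC : ∀ z, ‖f z‖ ≤ Real.exp (C * (1 + ‖z‖) ^ (3 / 2 : ℝ))) :
    ∃ A : ℝ, ∀ z, ‖f z‖ ≤ Real.exp (A * (1 + ‖z‖)) := by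
  obtain ⟨p, h, hh, hh0, hfph, ⟨B, hB⟩, R, hR⟩ :=
    exists_eq_mul_of_zeros_subset hfin.toFinset f hf hne (by simp)
  obtain ⟨g, hg, hhg⟩ := exists_eq_exp hh hh0
  obtain ⟨D, hD⟩ := (isCompact_closedBall (0 : ℂ) R).exists_bound_of_continuousOn
    (f := g) hg.continuous.continuousOn
  -- Far out `1 ≤ ‖p z‖` gives `‖h z‖ ≤ ‖f z‖`; the remaining disc is compact.
  have hre : ∀ z, (g z).re ≤ (|C| + |D|) * (1 + ‖z‖) ^ (3 / 2 : ℝ) := by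
    intro z
    have h1 : 1 ≤ (1 + ‖z‖) ^ (3 / 2 : ℝ) :=
      Real.one_le_rpow (by linarith [norm_nonneg z]) (by norm_num)
    rcases le_total R ‖z‖ with hz | hz
    · have : Real.exp (g z).re ≤ Real.exp (C * (1 + ‖z‖) ^ (3 / 2 : ℝ)) := by
        rw [← norm_exp, ← hhg]
        refine le_trans ?_ (hC z)
        rw [hfph, norm_mul]
        exact le_mul_of_one_le_left (norm_nonneg _) (hR z hz)
      have := Real.exp_le_exp.1 this
      nlinarith [le_abs_self C, abs_nonneg D]
    · have := (re_le_norm _).trans (hD z (by simpa using hz))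
      nlinarith [le_abs_self D, abs_nonneg C, abs_nonneg D]
  obtain ⟨A, hA⟩ := exists_norm_le_of_re_le hg hre
  refine ⟨B + A, fun z ↦ ?_⟩
  rw [hfph, norm_mul, hhg, norm_exp, add_mul, Real.exp_add]
  gcongr
  · exact hB z
  · exact (re_le_norm _).trans (hA z)

/-! ### The entire function `zetaXi` and its zeros -/

/-- Riemann's entire function `s (1 - s) Λ(s)`. -/
noncomputable def zetaXi (s : ℂ) : ℂ := s * (1 - s) * completedRiemannZeta₀ s - 1

theorem differentiable_zetaXi : Differentiable ℂ zetaXi := by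
  have := differentiable_completedZeta₀
  unfold zetaXi
  fun_prop

theorem zetaXi_one_sub (s : ℂ) : zetaXi (1 - s) = zetaXi s := by
  simp only [zetaXi, completedRiemannZeta₀_one_sub]
  ring

theorem zetaXi_zero : zetaXi 0 = -1 := by simp [zetaXi]

theorem zetaXi_eq_mul_completedRiemannZeta {s : ℂ} (h0 : s ≠ 0) (h1 : s ≠ 1) :
    zetaXi s = s * (1 - s) * completedRiemannZeta s := by
  have : 1 - s ≠ 0 := sub_ne_zero.2 h1.symm
  rw [completedRiemannZeta_eq, zetaXi]
  field_simp
  ring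

theorem riemannZeta_eq_zero_of_zetaXi_eq_zero {s : ℂ} (h : zetaXi s = 0) :
    riemannZeta s = 0 := by
  have h0 : s ≠ 0 := by
    rintro rfl
    simp [zetaXi_zero] at h
  have h1 : s ≠ 1 := by
    rintro rfl
    have := zetaXi_one_sub 0
    rw [sub_zero, h, zetaXi_zero] at this
    norm_num at this
  rw [zetaXi_eq_mul_completedRiemannZeta h0 h1] at h
  have h' : 1 - s ≠ 0 := sub_ne_zero.2 h1.symm
  rw [riemannZeta_def_of_ne_zero h0]
  simp_all

theorem zetaXi_ne_zero_of_one_le_re {s : ℂ} (hs : 1 ≤ s.re) : zetaXi s ≠ 0 := fun h ↦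
  riemannZeta_ne_zero_of_one_le_re hs (riemannZeta_eq_zero_of_zetaXi_eq_zero h)

theorem re_lt_one_of_zetaXi_eq_zero {s : ℂ} (h : zetaXi s = 0) : s.re < 1 :=
  not_le.1 fun hs ↦ zetaXi_ne_zero_of_one_le_re hs h

theorem re_pos_of_zetaXi_eq_zero {s : ℂ} (h : zetaXi s = 0) : 0 < s.re := by
  have := re_lt_one_of_zetaXi_eq_zero ((zetaXi_one_sub s).trans h)
  simpa using this

/-! ### Upper bound for the growth of `zetaXi` -/

theorem norm_Gamma_le {s : ℂ} (hs : 0 < s.re) : ‖Gamma s‖ ≤ Real.Gamma s.re := by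
  rw [Gamma_eq_integral hs, GammaIntegral, Real.Gamma_eq_integral hs]
  refine (norm_integral_le_integral_norm _).trans_eq ?_
  refine setIntegral_congr_fun measurableSet_Ioi fun x hx ↦ ?_
  simp only [norm_mul, norm_real, norm_cpow_eq_rpow_re_of_pos hx, sub_re, one_re]
  rw [Real.norm_of_nonneg (Real.exp_pos _).le]

/-- Compare with `n! ≤ exp (n log n)` and use `log n ≤ 2 √n`. Any exponent strictly between 1 and 2
would serve the Hadamard argument. -/
theorem Real.Gamma_le_exp {x : ℝ} (hx : 2 ≤ x) :
    Real.Gamma x ≤ Real.exp (2 * (x + 1) ^ (3 / 2 : ℝ)) := by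
  set n := ⌈x⌉₊
  have hn : x ≤ n := Nat.le_ceil x
  have hn' : (n : ℝ) ≤ x + 1 := (Nat.ceil_lt_add_one (by linarith)).le
  have hn0 : (0 : ℝ) < n := by linarith
  calc Real.Gamma x ≤ Real.Gamma (n + 1) :=
        Real.Gamma_strictMonoOn_Ici.monotoneOn hx (by simp; linarith) (by linarith)
    _ = n.factorial := Real.Gamma_nat_eq_factorial n
    _ ≤ (n : ℝ) ^ n := mod_cast n.factorial_le_pow
    _ = Real.exp (n * Real.log n) := by rw [Real.exp_nat_mul, Real.exp_log hn0]
    _ ≤ Real.exp (2 * (n : ℝ) ^ (3 / 2 : ℝ)) := by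
        refine Real.exp_le_exp.2 ?_
        have h := Real.log_le_rpow_div hn0.le (ε := 1 / 2) (by norm_num)
        have e : (n : ℝ) ^ (3 / 2 : ℝ) = n * (n : ℝ) ^ (1 / 2 : ℝ) := by
          conv_rhs => enter [1]; rw [← Real.rpow_one (n : ℝ)]
          rw [← Real.rpow_add hn0]
          norm_num
        rw [e]
        calc (n : ℝ) * Real.log n ≤ n * ((n : ℝ) ^ (1 / 2 : ℝ) / (1 / 2)) := by gcongr
          _ = _ := by ring
    _ ≤ _ := by gcongr

theorem norm_riemannZeta_le_of_two_le_re {s : ℂ} (hs : 2 ≤ s.re) :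
    ‖riemannZeta s‖ ≤ ∑' n : ℕ, 1 / ((n : ℝ) + 1) ^ 2 := by
  rw [zeta_eq_tsum_one_div_nat_add_one_cpow (by linarith)]
  have hsum : Summable fun n : ℕ ↦ 1 / ((n : ℝ) + 1) ^ 2 := by
    simpa using (summable_nat_add_iff 1).2 (Real.summable_one_div_nat_pow.2 one_lt_two)
  refine tsum_of_norm_bounded hsum.hasSum fun n ↦ ?_
  rw [norm_div, norm_one, ← Nat.cast_add_one, norm_natCast_cpow_of_pos n.succ_pos]
  push_cast
  gcongr
  rw [← Real.rpow_natCast]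
  exact Real.rpow_le_rpow_of_exponent_le (by linarith [n.cast_nonneg (α := ℝ)]) (by simpa)

/-- The entire part of the completed zeta function is bounded in vertical strips. -/
theorem exists_norm_completedRiemannZeta₀_le (a b : ℝ) :
    ∃ C : ℝ, ∀ s : ℂ, a ≤ s.re → s.re ≤ b → ‖completedRiemannZeta₀ s‖ ≤ C := by
  -- The Mellin integral of `P.f_modif` converges for every `s`, so the two edges of the strip
  -- dominate its interior: the edge `a` for `t ≤ 1`, the edge `b` for `t ≥ 1`.
  set P := HurwitzZeta.hurwitzEvenFEPair 0
  have hP (s : ℂ) : MellinConvergent P.f_modif s :=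
    (P.isStrongFEPair_toStrongFEPair.hasMellin s).1
  have hc (x : ℝ) : IntegrableOn (fun t : ℝ ↦ t ^ (x / 2 - 1) * ‖P.f_modif t‖) (Set.Ioi 0) := by
    refine IntegrableOn.congr_fun (Integrable.norm (hP (x / 2 : ℝ))) (fun t ht ↦ ?_)
      measurableSet_Ioi
    simp only [norm_smul, norm_cpow_eq_rpow_re_of_pos ht, sub_re, ofReal_re, one_re]
  refine ⟨(∫ t in Set.Ioi (0 : ℝ), (t ^ (a / 2 - 1) * ‖P.f_modif t‖ +
    t ^ (b / 2 - 1) * ‖P.f_modif t‖)) / 2, fun s ha hb ↦ ?_⟩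
  rw [completedRiemannZeta₀, HurwitzZeta.completedHurwitzZetaEven₀, norm_div, Complex.norm_ofNat,
    WeakFEPair.Λ₀, mellin]
  gcongr
  refine norm_integral_le_of_norm_le ((hc a).add (hc b)) ?_
  filter_upwards [ae_restrict_mem measurableSet_Ioi] with t ht
  rw [norm_smul, norm_cpow_eq_rpow_re_of_pos ht, ← add_mul]
  have ht0 : (0 : ℝ) < t := ht
  have hre : (s / 2 - 1).re = s.re / 2 - 1 := by
    rw [sub_re, one_re, show (2 : ℂ) = ((2 : ℝ) : ℂ) by norm_num, div_ofReal_re]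
  rw [hre]
  gcongr
  rcases le_total t 1 with h | h
  · refine (Real.rpow_le_rpow_of_exponent_ge ht0 h ?_).trans
      (le_add_of_nonneg_right (by positivity))
    linarith
  · refine (Real.rpow_le_rpow_of_exponent_le h ?_).trans
      (le_add_of_nonneg_left (by positivity))
    linarith

/-- The bound `4 ≤ s.re` puts `s / 2` in the range of `Real.Gamma_le_exp`. -/
theorem exists_norm_completedRiemannZeta_le :
    ∃ C : ℝ, 0 ≤ C ∧ ∀ s : ℂ, 4 ≤ s.re →
      ‖completedRiemannZeta s‖ ≤ C * Real.exp (2 * (1 + ‖s‖) ^ (3 / 2 : ℝ)) := by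
  refine ⟨∑' n : ℕ, 1 / ((n : ℝ) + 1) ^ 2, tsum_nonneg fun n ↦ by positivity, fun s hs ↦ ?_⟩
  have h0 : s ≠ 0 := by
    rintro rfl
    norm_num at hs
  have hG : Gammaℝ s ≠ 0 := Gammaℝ_ne_zero_of_re_pos (by linarith)
  have hre : (s / 2).re = s.re / 2 := by
    rw [show (2 : ℂ) = ((2 : ℝ) : ℂ) by norm_num, div_ofReal_re]
  have e : completedRiemannZeta s = riemannZeta s * Gammaℝ s := by
    rw [riemannZeta_def_of_ne_zero h0, div_mul_cancel₀ _ hG]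
  rw [e, norm_mul]
  gcongr
  · exact norm_riemannZeta_le_of_two_le_re (by linarith)
  · rw [Gammaℝ_def, norm_mul, norm_cpow_eq_rpow_re_of_pos Real.pi_pos]
    calc Real.pi ^ (-s / 2).re * ‖Gamma (s / 2)‖ ≤ 1 * Real.Gamma (s / 2).re := by
          gcongr
          · refine Real.rpow_le_one_of_one_le_of_nonpos (by linarith [Real.pi_gt_three]) ?_
            rw [neg_div, neg_re, hre]
            linarith
          · exact norm_Gamma_le (by rw [hre]; linarith)
      _ ≤ _ := by
          rw [one_mul, hre]
          refine (Real.Gamma_le_exp (by linarith)).trans ?_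
          have := re_le_norm s
          gcongr 3
          linarith

/-- The function `zetaXi` has growth order at most `3 / 2`. -/
theorem exists_norm_zetaXi_le :
    ∃ C : ℝ, ∀ s : ℂ, ‖zetaXi s‖ ≤ Real.exp (C * (1 + ‖s‖) ^ (3 / 2 : ℝ)) := by
  obtain ⟨A, hA⟩ := exists_norm_completedRiemannZeta₀_le 0 4
  obtain ⟨B, hB0, hB⟩ := exists_norm_completedRiemannZeta_le
  have hsq (s : ℂ) : ‖s * (1 - s)‖ ≤ Real.exp (2 * (1 + ‖s‖) ^ (3 / 2 : ℝ)) := by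
    have h1 : 1 + ‖s‖ ≤ (1 + ‖s‖) ^ (3 / 2 : ℝ) := by
      conv_lhs => rw [← Real.rpow_one (1 + ‖s‖)]
      exact Real.rpow_le_rpow_of_exponent_le (by linarith [norm_nonneg s]) (by norm_num)
    calc ‖s * (1 - s)‖ ≤ (1 + ‖s‖) * (1 + ‖s‖) := by
          rw [norm_mul]
          gcongr
          · linarith
          · simpa using norm_sub_le 1 s
      _ ≤ Real.exp ((1 + ‖s‖) ^ (3 / 2 : ℝ)) * Real.exp ((1 + ‖s‖) ^ (3 / 2 : ℝ)) := by
          have := Real.add_one_le_exp ((1 + ‖s‖) ^ (3 / 2 : ℝ))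
          gcongr <;> linarith
      _ = _ := by rw [← Real.exp_add]; ring_nf
  have hright (s : ℂ) (hs : 0 ≤ s.re) :
      ‖zetaXi s‖ ≤ Real.exp ((|A| + B + 5) * (1 + ‖s‖) ^ (3 / 2 : ℝ)) := by
    set x := (1 + ‖s‖) ^ (3 / 2 : ℝ)
    have hx : 1 ≤ x := Real.one_le_rpow (by linarith [norm_nonneg s]) (by norm_num)
    have h2 : 1 ≤ Real.exp (2 * x) := Real.one_le_exp (by linarith)
    have hK : |A| + B + 1 ≤ Real.exp ((|A| + B) * x) := by
      refine (Real.add_one_le_exp (|A| + B)).trans (Real.exp_le_exp.2 ?_)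
      exact le_mul_of_one_le_right (by positivity) hx
    have hle : ‖zetaXi s‖ ≤
        (|A| + B + 1) * (Real.exp (2 * x) * Real.exp (2 * x)) := by
      rcases le_total s.re 4 with h4 | h4
      · calc ‖zetaXi s‖ ≤ ‖s * (1 - s)‖ * ‖completedRiemannZeta₀ s‖ + 1 := by
              rw [zetaXi, ← norm_mul]
              simpa using norm_sub_le (s * (1 - s) * completedRiemannZeta₀ s) 1
          _ ≤ Real.exp (2 * x) * |A| + 1 := by
              gcongr
              · exact hsq s
              · exact (hA s hs h4).trans (le_abs_self A)
          _ ≤ (|A| + B + 1) * (Real.exp (2 * x) * 1) := by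
              nlinarith [abs_nonneg A]
          _ ≤ _ := by gcongr
      · have h0 : s ≠ 0 := by
          rintro rfl
          norm_num at h4
        have h1 : s ≠ 1 := by
          rintro rfl
          norm_num at h4
        rw [zetaXi_eq_mul_completedRiemannZeta h0 h1, norm_mul]
        calc _ ≤ Real.exp (2 * x) * (B * Real.exp (2 * x)) := by
              gcongr
              · exact hsq s
              · exact hB s h4
          _ = B * (Real.exp (2 * x) * Real.exp (2 * x)) := by ring
          _ ≤ _ := by
              gcongr
              linarith [abs_nonneg A]
    refine hle.trans ?_
    calc _ ≤ Real.exp ((|A| + B) * x) * (Real.exp (2 * x) * Real.exp (2 * x)) := by gcongr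
      _ = Real.exp ((|A| + B + 4) * x) := by
          rw [← Real.exp_add, ← Real.exp_add]; ring_nf
      _ ≤ _ := by gcongr; linarith
  -- The left half-plane is reached by `s ↦ 1 - s`, and `1 + ‖1 - s‖ ≤ 2 * (1 + ‖s‖)`.
  refine ⟨(|A| + B + 5) * 2 ^ (3 / 2 : ℝ), fun s ↦ ?_⟩
  have hscale : (2 : ℝ) ^ (3 / 2 : ℝ) * (1 + ‖s‖) ^ (3 / 2 : ℝ) =
      (2 * (1 + ‖s‖)) ^ (3 / 2 : ℝ) :=
    (Real.mul_rpow (by norm_num) (by positivity)).symm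
  rw [mul_assoc, hscale]
  rcases le_total 0 s.re with h | h
  · refine (hright s h).trans ?_
    gcongr
    linarith [norm_nonneg s]
  · rw [← zetaXi_one_sub]
    refine (hright (1 - s) (by simp; linarith)).trans ?_
    have : ‖1 - s‖ ≤ 1 + ‖s‖ := by simpa using norm_sub_le 1 s
    gcongr
    linarith [norm_nonneg s]

/-! ### Lower bound at even integers -/

theorem one_le_norm_riemannZeta_natCast {k : ℕ} (hk : 1 < k) : 1 ≤ ‖riemannZeta k‖ := by
  have hsum : Summable fun n : ℕ ↦ 1 / (n : ℝ) ^ k := Real.summable_one_div_nat_pow.2 hk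
  have e : riemannZeta k = ((∑' n : ℕ, 1 / (n : ℝ) ^ k : ℝ) : ℂ) := by
    rw [zeta_nat_eq_tsum_of_gt_one hk]
    push_cast
    rfl
  rw [e, norm_real, Real.norm_eq_abs]
  refine le_trans ?_ (le_abs_self _)
  simpa using hsum.le_tsum 1 fun n _ ↦ by positivity

/-- The left side is exactly the Gamma factor; the other factors have norm at least 1. -/
theorem factorial_div_le_norm_zetaXi (n : ℕ) (hn : 1 ≤ n) :
    (n.factorial : ℝ) / Real.pi ^ (n + 1) ≤ ‖zetaXi ((2 * (n + 1) : ℕ) : ℂ)‖ := by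
  set s : ℂ := ((2 * (n + 1) : ℕ) : ℂ) with hs
  have h0 : s ≠ 0 := Nat.cast_ne_zero.2 (by omega)
  have h1 : s ≠ 1 := by
    rw [hs, Ne, Nat.cast_eq_one]; omega
  have hG : Gammaℝ s ≠ 0 := Gammaℝ_ne_zero_of_re_pos (by rw [hs, natCast_re]; positivity)
  have hs2 : s / 2 = n + 1 := by
    rw [hs]; push_cast; ring
  have hGn : ‖Gammaℝ s‖ = (n.factorial : ℝ) / Real.pi ^ (n + 1) := by
    rw [Gammaℝ_def, norm_mul, norm_cpow_eq_rpow_re_of_pos Real.pi_pos, neg_div, hs2,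
      Gamma_nat_eq_factorial, norm_natCast]
    have : (-((n : ℂ) + 1)).re = -((n + 1 : ℕ) : ℝ) := by simp
    rw [this, Real.rpow_neg Real.pi_pos.le, Real.rpow_natCast]
    ring
  have e : completedRiemannZeta s = riemannZeta s * Gammaℝ s := by
    rw [riemannZeta_def_of_ne_zero h0, div_mul_cancel₀ _ hG]
  rw [zetaXi_eq_mul_completedRiemannZeta h0 h1, e, norm_mul, norm_mul, norm_mul, hGn]
  have hζ : 1 ≤ ‖riemannZeta s‖ := one_le_norm_riemannZeta_natCast (by omega)
  have hn1 : 1 ≤ ‖s‖ := by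
    rw [hs, norm_natCast]
    exact_mod_cast (by omega : 1 ≤ 2 * (n + 1))
  have hn2 : 1 ≤ ‖1 - s‖ := by
    have : 1 - s = -((2 * n + 1 : ℕ) : ℂ) := by
      rw [hs]; push_cast; ring
    rw [this, norm_neg, norm_natCast]
    exact_mod_cast (by omega : 1 ≤ 2 * n + 1)
  have hpos : 0 ≤ (n.factorial : ℝ) / Real.pi ^ (n + 1) := by positivity
  have := one_le_mul_of_one_le_of_one_le hn1 hn2
  have := one_le_mul_of_one_le_of_one_le this hζ
  rw [← mul_assoc]
  exact le_mul_of_one_le_left hpos this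

/-- The function `zetaXi` grows faster than any exponential function. -/
theorem not_exists_norm_zetaXi_le_exp :
    ¬ ∃ A : ℝ, ∀ s : ℂ, ‖zetaXi s‖ ≤ Real.exp (A * (1 + ‖s‖)) := by
  rintro ⟨A, hA⟩
  -- Exponential type would force `n! ≤ exp (3A) * π * (exp (2A) * π) ^ n`.
  have hlim := FloorSemiring.tendsto_pow_div_factorial_atTop (Real.exp (2 * A) * Real.pi)
  have hsmall := hlim.eventually (gt_mem_nhds
    (show 0 < 1 / (2 * (Real.exp (3 * A) * Real.pi)) by positivity))
  obtain ⟨n, hn, hn1⟩ := (hsmall.and (eventually_ge_atTop 1)).exists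
  have h := (factorial_div_le_norm_zetaXi n hn1).trans (hA _)
  rw [norm_natCast] at h
  have e : Real.exp (A * (1 + ((2 * (n + 1) : ℕ) : ℝ))) =
      Real.exp (2 * A) ^ n * Real.exp (3 * A) := by
    rw [← Real.exp_nat_mul, ← Real.exp_add]
    push_cast
    ring_nf
  have hf : (0 : ℝ) < n.factorial := mod_cast n.factorial_pos
  rw [e, div_le_iff₀ (by positivity)] at h
  rw [div_lt_div_iff₀ hf (by positivity), mul_pow] at hn
  rw [pow_succ] at h
  nlinarith

/-! ### Zeros of arbitrarily large height -/

/-- The completed zeta function has infinitely many zeros. -/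
theorem infinite_zetaXi_zeros : {s | zetaXi s = 0}.Infinite := by
  intro hfin
  obtain ⟨C, hC⟩ := exists_norm_zetaXi_le
  exact not_exists_norm_zetaXi_le_exp (exists_norm_le_exp_of_finite_zeros differentiable_zetaXi
    ⟨0, by simp [zetaXi_zero]⟩ hfin hC)

theorem exists_zetaXi_zero_lt_im (T : ℝ) (hRe : ∀ s, zetaXi s = 0 → s.re = 1 / 2) :
    ∃ s, zetaXi s = 0 ∧ T < s.im := by
  by_contra! h
  -- By the symmetry `s ↦ 1 - s`, heights bounded above are bounded below, so all zeros lie in one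
  -- compact disc.
  refine infinite_zetaXi_zeros (Set.Finite.subset
    ((isCompact_closedBall (0 : ℂ) (1 + |T|)).inter_riemannZetaZeros_finite) fun s hs ↦
      ⟨?_, riemannZeta_eq_zero_of_zetaXi_eq_zero hs⟩)
  have h1 := h s hs
  have h2 := h (1 - s) ((zetaXi_one_sub s).trans hs)
  simp only [sub_im, one_im, zero_sub] at h2
  have h3 : |s.im| ≤ |T| := by
    rw [abs_le]
    constructor <;> linarith [le_abs_self T]
  have := norm_le_abs_re_add_abs_im s
  rw [hRe s hs] at this
  norm_num at this
  rw [mem_closedBall_zero_iff]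
  linarith

theorem corollary3p2 (h : ∃ m : zetaZeroPoset, IsMax m) : ¬ RiemannHypothesis := by
  intro hRH
  have hline (s : ℂ) (hs : riemannZeta s = 0) (h0 : 0 ≤ s.re) : s.re = 1 / 2 := by
    refine hRH s hs ?_ ?_
    · rintro ⟨n, rfl⟩
      have : (-2 * ((n : ℂ) + 1)).re = -2 * ((n : ℝ) + 1) := by simp
      rw [this] at h0
      linarith [n.cast_nonneg (α := ℝ)]
    · rintro rfl
      exact riemannZeta_one_ne_zero hs
  obtain ⟨⟨m, hm0, hmz⟩, hmax⟩ := h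
  have hm_re : m.toComplex.re = 1 / 2 := hline _ hmz hm0.1
  have hm_im : 0 ≤ m.toComplex.im := hm0.2
  obtain ⟨s, hs, him⟩ := exists_zetaXi_zero_lt_im m.toComplex.im fun s hs ↦
    hline s (riemannZeta_eq_zero_of_zetaXi_eq_zero hs) (re_pos_of_zetaXi_eq_zero hs).le
  have hζ := riemannZeta_eq_zero_of_zetaXi_eq_zero hs
  have hs_re := hline s hζ (re_pos_of_zetaXi_eq_zero hs).le
  have hmem : CoordComplex.ofComplex s ∈ zetaZeroPoset :=
    ⟨⟨(re_pos_of_zetaXi_eq_zero hs).le, hm_im.trans him.le⟩, hζ⟩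
  have hle : (⟨m, hm0, hmz⟩ : zetaZeroPoset) ≤ ⟨CoordComplex.ofComplex s, hmem⟩ :=
    ⟨(hm_re.trans hs_re.symm).le, him.le⟩
  exact absurd (hmax hle).2 (not_le.2 him)
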